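/- Let $\Sigma=\{a,b\}$ be a two-letter alphabet. A finite word $w\in\Sigma^{*}$ is called Sturmian if it is balanced, i.e. if for any two factors (contiguous subwords) $u,v$ of $w$ with $|u|=|v|$ one has $\big||u|_{a}-|v|_{a}\big|\le 1$, where $|u|$ is the length of $u$ and $|u|_{a}$ is the number of occurrences of the letter $a$ in $u$. A Sturmian word $w$ is bispecial if $aw$, $bw$, $wa$ and $wb$ are all Sturmian. For every integer $n\ge 0$, the number of bispecial Sturmian words of length $n$ is $$2(n+1)-\varphi(n+2),$$ where $\varphi$ is Euler's totient function: $\varphi(m)$ is the number of integers $k$ with $1\le k\le m$ and $\gcd(k,m)=1$. -/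

import Mathlib

/-- The letters of the binary alphabet `Σ = {a, b}`. -/
inductive Letter : Type
  | a : Letter
  | b : Letter
  deriving DecidableEq

/-- Finite words over `Σ`. -/
abbrev Word : Type := List Letter

/-- A (finite) Sturmian word is a balanced word: any two factors (contiguous subwords) of the same
length contain the same number of occurrences of the letter `a` up to one. -/
def IsSturmian (w : Word) : Prop :=
  ∀ u v : Word, u <:+: w → v <:+: w → u.length = v.length →
    |(u.count Letter.a : ℤ) - (v.count Letter.a : ℤ)| ≤ 1

/-- A Sturmian word `w` is left special if `aw` and `bw` are both Sturmian. -/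
def IsLeftSpecial (w : Word) : Prop :=
  IsSturmian w ∧ IsSturmian ([Letter.a] ++ w) ∧ IsSturmian ([Letter.b] ++ w)

/-- A Sturmian word `w` is right special if `wa` and `wb` are both Sturmian. -/
def IsRightSpecial (w : Word) : Prop :=
  IsSturmian w ∧ IsSturmian (w ++ [Letter.a]) ∧ IsSturmian (w ++ [Letter.b])

/-- A bispecial Sturmian word is a Sturmian word that is both left and right special. -/
def IsBispecial (w : Word) : Prop :=
  IsLeftSpecial w ∧ IsRightSpecial w

/-- The set of bispecial Sturmian words of length `n`. -/
def bispecialWords (n : ℕ) : Set Word :=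
  {w | w.length = n ∧ IsBispecial w}

/-!
Throughout, `m = n + 2`. A word `w` of length `n` is described by its height function `H`, where
`H i` is the number of letters `b` among the first `i` letters of `aw`. Comparing factors of `w` with
the prefixes of `aw` and `bw` shows that `w` is left special if and only if `H` is additive up to a
carry, `H i + H j ≤ H (i + j) ≤ H i + H j + 1` for `i + j ≤ m - 1` (`isLeftSpecial_iff`). Right
specialness is the same condition on the reversed word, whose height function is
`H' j = k - 1 - H (m - j)`, where `k - 1` is the number of letters `b` in `w`.

If both conditions hold, then `H` follows the line of slope `k / m`. First, Euclid's algorithm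
gives `H i / i < (H j + 1) / j` for all `i` and `j` (`IsNearlyAdditive.mul_lt`), so that
`H j = ⌊j p / q⌋` for the largest ratio `p / q = H i / i`, in lowest terms. If `p / q` exceeded
`k / m`, then `q` would not divide `m`, and the condition on `H'` would fail at the sum of `m mod q`
and the inverse of `p` modulo `q` (`IsNearlyAdditive.mul_le`). With the symmetric statement for `H'` this yields
`i k / m - 1 ≤ H i ≤ i k / m`, and by Euclid's algorithm again equality cannot occur on both sides.
Hence `H i = ⌊i k / m⌋` for all `i`, or `H i = ⌈i k / m⌉ - 1` for all `i`
(`IsNearlyAdditive.eq_div_or_eq_div`). Conversely, both functions satisfy the conditions, and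
reversal exchanges them.

Each `k` in `{1, …, n + 1}` thus gives a lower and an upper word. Since `k` is determined by the
number of letters `b`, the only coincidences are between the two words of the same `k`, and these are
equal exactly when `k` is coprime to `m`. This leaves `2 (n + 1) - φ (n + 2)` words.
-/

/-- The height function of `w`: the number of letters `b` among the first `i` letters of `aw`. -/
def height (w : Word) (i : ℕ) : ℕ := ((Letter.a :: w).take i).count Letter.b

/-- `H` is additive up to a carry in `{0, 1}` on sums that do not exceed `N`. -/
def IsNearlyAdditive (N : ℕ) (H : ℕ → ℕ) : Prop :=
  ∀ i j, i + j ≤ N → H i + H j ≤ H (i + j) ∧ H (i + j) ≤ H i + H j + 1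

/-! ### Balanced words and height functions -/

theorem count_a_add_count_b (u : Word) : u.count Letter.a + u.count Letter.b = u.length := by
  induction u with
  | nil => simp
  | cons x u ih => cases x <;> simp <;> omega

theorem count_take_add (w : Word) (i L : ℕ) :
    (w.take (i + L)).count Letter.b =
      (w.take i).count Letter.b + ((w.drop i).take L).count Letter.b := by
  rw [List.take_add, List.count_append]

theorem isSturmian_iff (w : Word) :
    IsSturmian w ↔ ∀ i j L, i + L ≤ w.length → j + L ≤ w.length →
      (w.take (i + L)).count Letter.b + (w.take j).count Letter.b ≤
        (w.take i).count Letter.b + (w.take (j + L)).count Letter.b + 1 := by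
  constructor
  · intro h i j L hi hj
    have infix_take (i : ℕ) : (w.drop i).take L <:+: w :=
      (List.take_prefix _ _).isInfix.trans (List.drop_suffix _ _).isInfix
    have hlen (i : ℕ) (hi : i + L ≤ w.length) : ((w.drop i).take L).length = L := by
      simp; omega
    have := h _ _ (infix_take i) (infix_take j) (by rw [hlen i hi, hlen j hj])
    have h1 := count_a_add_count_b ((w.drop i).take L)
    have h2 := count_a_add_count_b ((w.drop j).take L)
    rw [hlen i hi] at h1
    rw [hlen j hj] at h2
    rw [count_take_add, count_take_add, abs_le] at *
    omega
  · intro h u v hu hv huv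
    have key (u : Word) (hu : u <:+: w) : ∃ i, i + u.length ≤ w.length ∧
        (w.take (i + u.length)).count Letter.b = (w.take i).count Letter.b + u.count Letter.b := by
      obtain ⟨s, t, rfl⟩ := hu
      refine ⟨s.length, by simp, ?_⟩
      rw [count_take_add]
      simp
    obtain ⟨i, hi, hci⟩ := key u hu
    obtain ⟨j, hj, hcj⟩ := key v hv
    have h1 := h i j u.length hi (by omega)
    have h2 := h j i u.length (by omega) hi
    have h3 := count_a_add_count_b u
    have h4 := count_a_add_count_b v
    rw [← huv] at hcj
    rw [abs_le]
    omega

theorem IsSturmian.of_infix {u w : Word} (h : IsSturmian w) (hu : u <:+: w) : IsSturmian u :=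
  fun x y hx hy hxy => h x y (hx.trans hu) (hy.trans hu) hxy

theorem IsSturmian.reverse {w : Word} (h : IsSturmian w) : IsSturmian w.reverse := by
  intro u v hu hv huv
  have := h u.reverse v.reverse (List.reverse_infix.1 (by simpa using hu))
    (List.reverse_infix.1 (by simpa using hv)) (by simpa using huv)
  simpa using this

theorem isSturmian_reverse {w : Word} : IsSturmian w.reverse ↔ IsSturmian w :=
  ⟨fun h => by simpa using h.reverse, IsSturmian.reverse⟩

theorem isRightSpecial_iff_reverse (w : Word) : IsRightSpecial w ↔ IsLeftSpecial w.reverse := by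
  have h (x : Letter) : IsSturmian ([x] ++ w.reverse) ↔ IsSturmian (w ++ [x]) := by
    rw [← isSturmian_reverse]; simp
  rw [IsRightSpecial, IsLeftSpecial, h, h, isSturmian_reverse]

theorem count_take_b_cons (w : Word) (i : ℕ) :
    ((Letter.b :: w).take i).count Letter.b = height w i + if i = 0 then 0 else 1 := by
  cases i <;> simp [height]

@[simp] theorem height_zero (w : Word) : height w 0 = 0 := by simp [height]

@[simp] theorem height_one (w : Word) : height w 1 = 0 := by simp [height]

/-- The prefixes of length `j` of `aw` and `bw` contain `height w j` and `height w j + 1` letters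
`b`, so both extensions are balanced exactly when every factor of `w` of length `j` has one of these
two numbers of letters `b`. -/
theorem isLeftSpecial_iff (w : Word) :
    IsLeftSpecial w ↔ IsNearlyAdditive (w.length + 1) (height w) := by
  constructor
  · rintro ⟨-, ha, hb⟩ i j hij
    rw [isSturmian_iff] at ha hb
    have h1 := ha i 0 j (by simpa using hij) (by simp; omega)
    have h2 := hb 0 i j (by simp; omega) (by simpa using hij)
    simp only [List.singleton_append, count_take_b_cons] at h1 h2
    change height w (i + j) + height w 0 ≤ height w i + height w (0 + j) + 1 at h1
    simp only [zero_add, height_zero, add_zero] at h1 h2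
    refine ⟨?_, by omega⟩
    rcases Nat.eq_zero_or_pos i with rfl | hi
    · simp
    rcases Nat.eq_zero_or_pos j with rfl | hj
    · simp
    simp only [hi.ne', hj.ne', Nat.add_eq_zero_iff, false_and, if_true, if_false] at h2
    omega
  · intro h
    have ha : IsSturmian ([Letter.a] ++ w) := by
      rw [isSturmian_iff]
      intro i j L hi hj
      have h1 := h i L (by simpa using hi)
      have h2 := h j L (by simpa using hj)
      change height w (i + L) + height w j ≤ height w i + height w (j + L) + 1
      omega
    refine ⟨ha.of_infix (List.suffix_append _ _).isInfix, ha, ?_⟩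
    rw [isSturmian_iff]
    intro i j L hi hj
    have h1 := h i L (by simpa using hi)
    have h2 := h j L (by simpa using hj)
    simp only [List.singleton_append, count_take_b_cons]
    have h0 := height_zero w
    rcases Nat.eq_zero_or_pos i with rfl | hi <;> rcases Nat.eq_zero_or_pos j with rfl | hj <;>
      rcases Nat.eq_zero_or_pos L with rfl | hL <;> simp_all <;> split_ifs <;> omega

theorem isBispecial_iff (w : Word) :
    IsBispecial w ↔ IsNearlyAdditive (w.length + 1) (height w) ∧
      IsNearlyAdditive (w.length + 1) (height w.reverse) := by
  rw [IsBispecial, isRightSpecial_iff_reverse, isLeftSpecial_iff, isLeftSpecial_iff,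
    List.length_reverse]

theorem height_succ (w : Word) (i : ℕ) : height w (i + 1) = (w.take i).count Letter.b := by
  simp [height]

theorem height_reverse (w : Word) {i j : ℕ} (hi : 1 ≤ i) (hj : 1 ≤ j)
    (hij : i + j = w.length + 2) :
    height w.reverse i + height w j = w.count Letter.b := by
  obtain ⟨i, rfl⟩ := Nat.exists_eq_add_of_le' hi
  obtain ⟨j, rfl⟩ := Nat.exists_eq_add_of_le' hj
  rw [height_succ, height_succ, List.take_reverse, List.count_reverse,
    show w.length - i = j by omega, add_comm, ← List.count_append, List.take_append_drop]

theorem height_succ_succ (w : Word) (i : ℕ) (hi : i < w.length) :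
    height w (i + 2) = height w (i + 1) + if w[i] = Letter.b then 1 else 0 := by
  rw [height_succ, height_succ, List.take_add_one, List.count_append]
  simp [hi, List.count_singleton]

theorem eq_of_height_eq {v w : Word} (hl : v.length = w.length)
    (h : ∀ i, 1 ≤ i → i ≤ w.length + 1 → height v i = height w i) : v = w := by
  refine List.ext_getElem hl fun i hv hw => ?_
  have h1 := height_succ_succ v i hv
  have h2 := height_succ_succ w i hw
  rw [h _ (by omega) (by omega), h _ (by omega) (by omega), h2] at h1
  rcases hx : v[i] <;> rcases hy : w[i] <;> simp [hx, hy] at h1 ⊢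

/-- The word of length `n` whose height function is `f` on `{1, …, n + 1}`, provided `f` starts with
`f 1 = 0` and has steps `0` and `1`. -/
def ofHeight (n : ℕ) (f : ℕ → ℕ) : Word :=
  (List.range n).map fun i => if f (i + 2) = f (i + 1) then Letter.a else Letter.b

@[simp] theorem length_ofHeight (n : ℕ) (f : ℕ → ℕ) : (ofHeight n f).length = n := by
  simp [ofHeight]

theorem height_ofHeight {n : ℕ} {f : ℕ → ℕ} (h1 : f 1 = 0)
    (hf : ∀ i, f (i + 1) = f i ∨ f (i + 1) = f i + 1) {i : ℕ} (hi : 1 ≤ i) (hin : i ≤ n + 1) :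
    height (ofHeight n f) i = f i := by
  induction i, hi using Nat.le_induction with
  | base => simp [h1]
  | succ i hi ih =>
    obtain ⟨i, rfl⟩ := Nat.exists_eq_add_of_le' hi
    rw [height_succ_succ _ _ (by simp; omega), ih (by omega)]
    have := hf (i + 1)
    simp only [ofHeight, List.getElem_map, List.getElem_range]
    split_ifs <;> simp_all

/-! ### Nearly additive functions -/

/-- The intervals `[H i / i, (H i + 1) / i)` have a common point. Subtracting the smaller of the two
arguments from the larger, as in Euclid's algorithm, reduces to equal arguments. -/
theorem IsNearlyAdditive.mul_lt {N : ℕ} {H : ℕ → ℕ} (h : IsNearlyAdditive N H) {i j : ℕ}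
    (hi : 1 ≤ i) (hiN : i ≤ N) (hj : 1 ≤ j) (hjN : j ≤ N) : H i * j < (H j + 1) * i := by
  induction hs : i + j using Nat.strong_induction_on generalizing i j with
  | _ s ih =>
  rcases lt_trichotomy i j with hij | rfl | hij
  · obtain ⟨d, rfl⟩ := Nat.exists_eq_add_of_lt hij
    have h1 := ih (i + (d + 1)) (by omega) hi hiN (j := d + 1) (by omega) (by omega) rfl
    have h2 := (h i (d + 1) (by omega)).1
    rw [← add_assoc] at h2
    nlinarith
  · nlinarith
  · obtain ⟨d, rfl⟩ := Nat.exists_eq_add_of_lt hij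
    have h1 := ih ((d + 1) + j) (by omega) (i := d + 1) (by omega) (by omega) hj hjN rfl
    have h2 := (h j (d + 1) (by omega)).2
    rw [← add_assoc] at h2
    nlinarith

/-- If `H` and the function `i ↦ k - 1 - H (m - i)` are nearly additive, then the graph of `H` lies
weakly below the line of slope `k / m`. -/
theorem IsNearlyAdditive.mul_le {m k : ℕ} {H H' : ℕ → ℕ} (h : IsNearlyAdditive (m - 1) H)
    (h' : IsNearlyAdditive (m - 1) H') (h1 : H 1 = 0) (h1' : H' 1 = 0)
    (hk : ∀ i j, 1 ≤ i → 1 ≤ j → i + j = m → H' i + H j + 1 = k)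
    {i : ℕ} (hi : 1 ≤ i) (him : i < m) : m * H i ≤ i * k := by
  by_contra! hlt
  -- `p / q` is the largest of the ratios `H j / j`, in lowest terms.
  obtain ⟨i₀, hi₀, hmax⟩ := Finset.exists_max_image (Finset.Ico 1 m)
    (fun j => (H j : ℚ) / j) ⟨i, by simp; omega⟩
  simp only [Finset.mem_Ico] at hi₀ hmax
  obtain ⟨p, q, hpq, hp, hq⟩ := Nat.exists_coprime (H i₀) i₀
  set g := (H i₀).gcd i₀
  have hg : 0 < g := Nat.gcd_pos_of_pos_right _ (by omega)
  have hq0 : 0 < q := Nat.pos_of_ne_zero fun h0 => by subst h0; omega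
  have hqm : q < m := lt_of_le_of_lt (by rw [hq]; exact Nat.le_mul_of_pos_right _ hg) hi₀.2
  have hle (j : ℕ) (hj : 1 ≤ j) (hjm : j < m) : H j * q ≤ j * p := by
    have := hmax j ⟨hj, hjm⟩
    rw [div_le_div_iff₀ (by positivity) (by norm_cast; omega)] at this
    norm_cast at this
    rw [hp] at this
    nth_rewrite 1 [hq] at this
    refine Nat.le_of_mul_le_mul_right (c := g) ?_ hg
    linarith
  have hlt' (j : ℕ) (hj : 1 ≤ j) (hjm : j < m) : j * p < (H j + 1) * q := by
    have := h.mul_lt hi₀.1 (by omega) hj (by omega)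
    rw [hp] at this
    nth_rewrite 1 [hq] at this
    refine Nat.lt_of_mul_lt_mul_right (a := g) ?_
    linarith
  have hslope : q * k < m * p := by
    have h2 := hle i hi him
    refine Nat.lt_of_mul_lt_mul_left (a := i) ?_
    calc i * (q * k) = q * (i * k) := by ring
      _ < q * (m * H i) := Nat.mul_lt_mul_of_pos_left hlt hq0
      _ = m * (H i * q) := by ring
      _ ≤ m * (i * p) := Nat.mul_le_mul_left _ h2
      _ = i * (m * p) := by ring
  have hpq' : p < q := by simpa [h1] using hlt' 1 le_rfl (by omega)
  have hp0 : 0 < p := Nat.pos_of_ne_zero fun h0 => by subst h0; omega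
  -- `l` is the inverse of `p` modulo `q`.
  obtain ⟨l, hlq, hl⟩ := Nat.exists_mul_mod_eq_one_of_coprime hpq (by omega)
  have hl0 : 1 ≤ l := Nat.pos_of_ne_zero fun h0 => by subst h0; simp at hl
  have hlu := Nat.div_add_mod (p * l) q
  rw [hl] at hlu
  set u := p * l / q
  have hmt := Nat.div_add_mod m q
  have hrq := Nat.mod_lt m hq0
  set t := m / q
  set r := m % q
  have ht0 : 1 ≤ t := (Nat.one_le_div_iff hq0).2 hqm.le
  rcases Nat.eq_zero_or_pos r with hr | hr
  · -- If `q` divides `m`, the value `H (m - 1) = k - 1` forces `k / m ≥ p / q`.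
    have h2 := hk 1 (m - 1) le_rfl (by omega) (by omega)
    have h3 := hlt' (m - 1) (by omega) (by omega)
    obtain ⟨m, rfl⟩ : ∃ m', m = m' + 1 := ⟨m - 1, by omega⟩
    simp only [Nat.add_sub_cancel] at *
    rw [show H m + 1 = k by omega] at h3
    have h4 : k < t * p := Nat.lt_of_mul_lt_mul_left (a := q) (by nlinarith)
    nlinarith
  · -- Near additivity of `H'` fails at `r + l`.
    have hqt : q ≤ q * t := Nat.le_mul_of_pos_right _ ht0
    have e1 := hk r (q * t) hr (by omega) (by omega)
    have e2 := hk l (m - l) hl0 (by omega) (by omega)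
    have e3 := hk (r + l) (q * t - l) (by omega) (by omega) (by omega)
    have e4 := (h' r l (by omega)).2
    have f1 := hlt' (q * t) (by omega) (by omega)
    have f2 := hlt' (m - l) (by omega) (by omega)
    have f3 := hle (q * t - l) (by omega) (by omega)
    have g1 : t * p < H (q * t) + 1 := Nat.lt_of_mul_lt_mul_left (a := q) (by linarith)
    have g2 : k < H (m - l) + 1 + u := by
      refine Nat.lt_of_mul_lt_mul_left (a := q) ?_
      have : (m - l) * p + l * p = m * p := by rw [← add_mul]; congr 1; omega
      linarith
    have g3 : H (q * t - l) + u < t * p := by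
      refine Nat.lt_of_mul_lt_mul_left (a := q) ?_
      have : (q * t - l) * p + l * p = q * t * p := by rw [← add_mul]; congr 1; omega
      linarith
    omega

/-- A nearly additive function whose reflection is nearly additive follows the line of slope `k / m`
from below, with all lattice points of the line included or all of them excluded. -/
theorem IsNearlyAdditive.eq_div_or_eq_div {m k : ℕ} {H H' : ℕ → ℕ}
    (h : IsNearlyAdditive (m - 1) H) (h' : IsNearlyAdditive (m - 1) H')
    (h1 : H 1 = 0) (h1' : H' 1 = 0)
    (hk : ∀ i j, 1 ≤ i → 1 ≤ j → i + j = m → H' i + H j + 1 = k) :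
    (∀ i, 1 ≤ i → i < m → H i = i * k / m) ∨ (∀ i, 1 ≤ i → i < m → H i = (i * k - 1) / m) := by
  have hup (i : ℕ) (hi : 1 ≤ i) (him : i < m) : m * H i ≤ i * k :=
    h.mul_le h' h1 h1' hk hi him
  have hlow (i : ℕ) (hi : 1 ≤ i) (him : i < m) : i * k ≤ (H i + 1) * m := by
    have h2 := h'.mul_le h h1' h1 (k := k)
      (fun i j hi hj hij => by have := hk j i hj hi (by omega); omega)
      (i := m - i) (by omega) (by omega)
    have h3 := hk (m - i) i (by omega) hi (by omega)
    obtain ⟨j, rfl⟩ : ∃ j, m = i + j := ⟨m - i, by omega⟩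
    simp only [Nat.add_sub_cancel_left] at *
    nlinarith
  by_cases hcase : ∀ i, 1 ≤ i → i < m → i * k < (H i + 1) * m
  · left
    intro i hi him
    refine (Nat.div_eq_of_lt_le ?_ ?_).symm
    · rw [mul_comm]; exact hup i hi him
    · exact hcase i hi him
  · right
    push Not at hcase
    obtain ⟨j, hj, hjm, hjk⟩ := hcase
    intro i hi him
    -- A point of the line met from below at `j` excludes one met from above at `i`.
    have hne : m * H i < i * k := by
      have h2 := h.mul_lt hi (by omega) hj (by omega)
      refine Nat.lt_of_mul_lt_mul_left (a := j) ?_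
      calc j * (m * H i) = m * (H i * j) := by ring
        _ < m * ((H j + 1) * i) := Nat.mul_lt_mul_of_pos_left h2 (by omega)
        _ = i * ((H j + 1) * m) := by ring
        _ ≤ i * (j * k) := Nat.mul_le_mul_left _ hjk
        _ = j * (i * k) := by ring
    have := hlow i hi him
    refine (Nat.div_eq_of_lt_le ?_ ?_).symm
    · rw [mul_comm]; omega
    · omega

theorem isNearlyAdditive_div (N m k : ℕ) : IsNearlyAdditive N fun i => i * k / m := by
  intro i j _
  dsimp only
  rcases Nat.eq_zero_or_pos m with rfl | hm
  · simp
  rw [add_mul]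
  exact ⟨Nat.div_add_div_le_add_div, by rw [Nat.add_div hm]; split_ifs <;> omega⟩

theorem isNearlyAdditive_sub_one_div (N : ℕ) {m k : ℕ} (hm : 0 < m) (hk : 0 < k) :
    IsNearlyAdditive N fun i => (i * k - 1) / m := by
  intro i j _
  dsimp only
  rcases Nat.eq_zero_or_pos i with rfl | hi
  · simp
  rcases Nat.eq_zero_or_pos j with rfl | hj
  · simp
  have hik := Nat.mul_pos hi hk
  have hjk := Nat.mul_pos hj hk
  have e : (i + j) * k - 1 = (i * k - 1) + (j * k - 1) + 1 := by rw [add_mul]; omega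
  rw [e]
  generalize i * k - 1 = x
  generalize j * k - 1 = y
  refine ⟨(Nat.div_add_div_le_add_div).trans (Nat.div_le_div_right (by omega)), ?_⟩
  rw [← Nat.lt_succ_iff, Nat.div_lt_iff_lt_mul hm]
  have h1 := Nat.lt_div_mul_add (a := x) hm
  have h2 := Nat.lt_div_mul_add (a := y) hm
  rw [Nat.succ_eq_add_one]
  nlinarith

/-! ### The two families of bispecial words -/

/-- The internal factor `w` of the word `awb` coding the lattice path just below the segment from
`(0, 0)` to `(n + 2 - k, k)`. -/
def lowerWord (n k : ℕ) : Word := ofHeight n fun i => i * k / (n + 2)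

/-- The internal factor `w` of the word `bwa` coding the lattice path just above the segment from
`(0, 0)` to `(n + 2 - k, k)`. For `x > 0`, the value `(x - 1) / m` of natural number division is
`⌈x / m⌉ - 1`. -/
def upperWord (n k : ℕ) : Word := ofHeight n fun i => (i * k - 1) / (n + 2)

theorem height_lowerWord {n k : ℕ} (hk : k ≤ n + 1) {i : ℕ} (hi : 1 ≤ i) (hin : i ≤ n + 1) :
    height (lowerWord n k) i = i * k / (n + 2) := by
  refine height_ofHeight (f := fun i => i * k / (n + 2)) ?_ (fun i => ?_) hi hin
  · exact Nat.div_eq_of_lt (by omega)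
  · have := isNearlyAdditive_div (i + 1) (n + 2) k i 1 le_rfl
    simp only [one_mul, Nat.div_eq_of_lt (show k < n + 2 by omega)] at this ⊢
    omega

theorem height_upperWord {n k : ℕ} (hk0 : 1 ≤ k) (hk : k ≤ n + 1) {i : ℕ} (hi : 1 ≤ i)
    (hin : i ≤ n + 1) : height (upperWord n k) i = (i * k - 1) / (n + 2) := by
  refine height_ofHeight (f := fun i => (i * k - 1) / (n + 2)) ?_ (fun i => ?_) hi hin
  · exact Nat.div_eq_of_lt (by omega)
  · have := isNearlyAdditive_sub_one_div (i + 1) (m := n + 2) (by omega) hk0 i 1 le_rfl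
    simp only [one_mul, Nat.div_eq_of_lt (show k - 1 < n + 2 by omega)] at this ⊢
    omega

theorem count_b_eq_height (w : Word) : w.count Letter.b = height w (w.length + 1) := by
  rw [height_succ, List.take_length]

theorem count_lowerWord {n k : ℕ} (hk0 : 1 ≤ k) (hk : k ≤ n + 1) :
    (lowerWord n k).count Letter.b + 1 = k := by
  have hl : (lowerWord n k).length = n := length_ofHeight _ _
  rw [count_b_eq_height, hl, height_lowerWord hk (by omega) le_rfl]
  obtain ⟨c, rfl⟩ := Nat.exists_eq_add_of_le' hk0
  congr 1
  apply Nat.div_eq_of_lt_le <;> nlinarith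

theorem count_upperWord {n k : ℕ} (hk0 : 1 ≤ k) (hk : k ≤ n + 1) :
    (upperWord n k).count Letter.b + 1 = k := by
  have hl : (upperWord n k).length = n := length_ofHeight _ _
  rw [count_b_eq_height, hl, height_upperWord hk0 hk (by omega) le_rfl]
  obtain ⟨c, rfl⟩ := Nat.exists_eq_add_of_le' hk0
  congr 1
  have : (n + 1) * (c + 1) - 1 = (n + 1) * c + n := by rw [mul_add]; omega
  rw [this]
  apply Nat.div_eq_of_lt_le <;> nlinarith

theorem div_add_sub_one_div {m k x y : ℕ} (hm : 0 < m) (hx : 0 < x)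
    (hxy : x + y = m * k) : (x - 1) / m + y / m + 1 = k := by
  have h1 := Nat.div_add_mod (x - 1) m
  have h2 := Nat.div_add_mod y m
  have h3 := Nat.mod_lt (x - 1) hm
  have h4 := Nat.mod_lt y hm
  have h5 : m * ((x - 1) / m + y / m) < m * k := by rw [mul_add]; omega
  have h6 : m * k < m * ((x - 1) / m + y / m + 2) := by rw [mul_add, mul_add]; omega
  have h7 := Nat.lt_of_mul_lt_mul_left h5
  have h8 := Nat.lt_of_mul_lt_mul_left h6
  omega

theorem reverse_lowerWord {n k : ℕ} (hk0 : 1 ≤ k) (hk : k ≤ n + 1) :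
    (lowerWord n k).reverse = upperWord n k := by
  have hl : (lowerWord n k).length = n := length_ofHeight _ _
  have hu : (upperWord n k).length = n := length_ofHeight _ _
  refine eq_of_height_eq (by rw [List.length_reverse, hl, hu]) fun i hi hin => ?_
  rw [hu] at hin
  have h1 := height_reverse (lowerWord n k) hi (j := n + 2 - i) (by omega) (by omega)
  rw [height_lowerWord hk (by omega) (by omega)] at h1
  rw [height_upperWord hk0 hk hi hin]
  have h2 := count_lowerWord hk0 hk
  have h3 := div_add_sub_one_div (m := n + 2) (x := i * k) (y := (n + 2 - i) * k) (by omega)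
    (Nat.mul_pos hi hk0) (by rw [← add_mul]; congr 1; omega)
  omega

theorem IsNearlyAdditive.congr {N : ℕ} {H H' : ℕ → ℕ} (h : IsNearlyAdditive N H)
    (hH : ∀ i, i ≤ N → H' i = H i) : IsNearlyAdditive N H' := by
  intro i j hij
  rw [hH i (by omega), hH j (by omega), hH _ hij]
  exact h i j hij

theorem isNearlyAdditive_height_lowerWord {n k : ℕ} (hk : k ≤ n + 1) :
    IsNearlyAdditive (n + 1) (height (lowerWord n k)) := by
  refine (isNearlyAdditive_div (n + 1) (n + 2) k).congr fun i hi => ?_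
  rcases Nat.eq_zero_or_pos i with rfl | h0
  · simp
  · exact height_lowerWord hk h0 hi

theorem isNearlyAdditive_height_upperWord {n k : ℕ} (hk0 : 1 ≤ k) (hk : k ≤ n + 1) :
    IsNearlyAdditive (n + 1) (height (upperWord n k)) := by
  refine (isNearlyAdditive_sub_one_div (n + 1) (m := n + 2) (by omega) hk0).congr fun i hi => ?_
  rcases Nat.eq_zero_or_pos i with rfl | h0
  · simp
  · exact height_upperWord hk0 hk h0 hi

theorem isBispecial_lowerWord {n k : ℕ} (hk0 : 1 ≤ k) (hk : k ≤ n + 1) :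
    IsBispecial (lowerWord n k) := by
  have hl : (lowerWord n k).length = n := length_ofHeight _ _
  rw [isBispecial_iff, reverse_lowerWord hk0 hk, hl]
  exact ⟨isNearlyAdditive_height_lowerWord hk, isNearlyAdditive_height_upperWord hk0 hk⟩

theorem isBispecial_upperWord {n k : ℕ} (hk0 : 1 ≤ k) (hk : k ≤ n + 1) :
    IsBispecial (upperWord n k) := by
  have hl : (upperWord n k).length = n := length_ofHeight _ _
  rw [isBispecial_iff, hl, ← reverse_lowerWord hk0 hk, List.reverse_reverse,
    reverse_lowerWord hk0 hk]
  exact ⟨isNearlyAdditive_height_upperWord hk0 hk, isNearlyAdditive_height_lowerWord hk⟩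

theorem IsBispecial.eq_lowerWord_or_eq_upperWord {w : Word} (h : IsBispecial w) :
    w = lowerWord w.length (w.count Letter.b + 1) ∨
      w = upperWord w.length (w.count Letter.b + 1) := by
  rw [isBispecial_iff] at h
  have hk : w.count Letter.b + 1 ≤ w.length + 1 := by simpa using List.count_le_length
  have hl : (lowerWord w.length (w.count Letter.b + 1)).length = w.length := length_ofHeight _ _
  have hu : (upperWord w.length (w.count Letter.b + 1)).length = w.length := length_ofHeight _ _
  refine (IsNearlyAdditive.eq_div_or_eq_div (m := w.length + 2) (k := w.count Letter.b + 1)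
    h.1 h.2 (height_one _) (height_one _)
    (fun i j hi hj hij => by rw [height_reverse w hi hj hij])).imp ?_ ?_
  · intro hw
    refine eq_of_height_eq hl.symm fun i hi hin => ?_
    rw [height_lowerWord hk hi (by omega), hw i hi (by omega)]
  · intro hw
    refine eq_of_height_eq hu.symm fun i hi hin => ?_
    rw [height_upperWord (by omega) hk hi (by omega), hw i hi (by omega)]

/-! ### Counting -/

theorem div_eq_sub_one_div_iff {m x : ℕ} (hx : 0 < x) :
    x / m = (x - 1) / m ↔ ¬ m ∣ x := by
  obtain ⟨y, rfl⟩ := Nat.exists_eq_add_of_le' hx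
  rw [Nat.add_sub_cancel, Nat.succ_div]
  split_ifs with h <;> simp [h]

/-- The two words with the same slope differ exactly when the segment passes through a lattice point
other than its endpoints. -/
theorem lowerWord_eq_upperWord_iff {n k : ℕ} (hk0 : 1 ≤ k) (hk : k ≤ n + 1) :
    lowerWord n k = upperWord n k ↔ (n + 2).Coprime k := by
  have hl : (lowerWord n k).length = n := length_ofHeight _ _
  have hu : (upperWord n k).length = n := length_ofHeight _ _
  constructor
  · intro h
    by_contra hc
    -- The first interior lattice point on the segment.
    set d := (n + 2).gcd k with hd
    have hd0 : 0 < d := Nat.gcd_pos_of_pos_left _ (by omega)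
    have hd1 : 1 < d := lt_of_le_of_ne hd0 (Ne.symm hc)
    obtain ⟨i, hi⟩ : d ∣ n + 2 := Nat.gcd_dvd_left _ _
    obtain ⟨c, hkc⟩ : d ∣ k := Nat.gcd_dvd_right _ _
    have hi0 : 1 ≤ i := Nat.pos_of_ne_zero fun h0 => by subst h0; omega
    have hin : i ≤ n + 1 := by nlinarith
    have h1 := congrArg (height · i) h
    simp only [height_lowerWord hk hi0 hin, height_upperWord hk0 hk hi0 hin] at h1
    refine (div_eq_sub_one_div_iff (Nat.mul_pos hi0 hk0)).1 h1 ⟨c, ?_⟩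
    rw [hi, hkc]; ring
  · intro hc
    refine eq_of_height_eq (hl.trans hu.symm) fun i hi hin => ?_
    rw [hu] at hin
    rw [height_lowerWord hk hi hin, height_upperWord hk0 hk hi hin,
      div_eq_sub_one_div_iff (Nat.mul_pos hi hk0)]
    intro hdvd
    have := Nat.le_of_dvd hi (hc.dvd_of_dvd_mul_right hdvd)
    omega

theorem bispecialWords_eq (n : ℕ) :
    bispecialWords n = ((Finset.Icc 1 (n + 1)).image (lowerWord n) ∪
      (Finset.Icc 1 (n + 1)).image (upperWord n) : Finset Word) := by
  ext w
  simp only [bispecialWords, Set.mem_ofPred_eq, Finset.coe_union, Finset.coe_image, Set.mem_union,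
    Set.mem_image, Finset.coe_Icc, Set.mem_Icc]
  constructor
  · rintro ⟨rfl, hw⟩
    have hk : w.count Letter.b + 1 ≤ w.length + 1 := by simpa using List.count_le_length
    exact hw.eq_lowerWord_or_eq_upperWord.imp (fun h => ⟨_, ⟨by omega, hk⟩, h.symm⟩)
      (fun h => ⟨_, ⟨by omega, hk⟩, h.symm⟩)
  · rintro (⟨k, ⟨hk0, hk⟩, rfl⟩ | ⟨k, ⟨hk0, hk⟩, rfl⟩)
    · exact ⟨length_ofHeight _ _, isBispecial_lowerWord hk0 hk⟩
    · exact ⟨length_ofHeight _ _, isBispecial_upperWord hk0 hk⟩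

theorem image_lowerWord_inter_image_upperWord (n : ℕ) :
    (Finset.Icc 1 (n + 1)).image (lowerWord n) ∩ (Finset.Icc 1 (n + 1)).image (upperWord n) =
      ((Finset.range (n + 2)).filter fun k => (n + 2).Coprime k).image (lowerWord n) := by
  ext w
  simp only [Finset.mem_inter, Finset.mem_image, Finset.mem_Icc, Finset.mem_filter,
    Finset.mem_range]
  constructor
  · rintro ⟨⟨k, ⟨hk0, hk⟩, rfl⟩, l, ⟨hl0, hl⟩, h⟩
    have h1 := count_lowerWord hk0 hk
    have h2 := count_upperWord hl0 hl
    rw [h, h1] at h2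
    subst h2
    exact ⟨k, ⟨by omega, (lowerWord_eq_upperWord_iff hk0 hk).1 h.symm⟩, rfl⟩
  · rintro ⟨k, ⟨hk, hc⟩, rfl⟩
    have hk0 : 1 ≤ k := Nat.pos_of_ne_zero fun h0 => by subst h0; simp at hc
    exact ⟨⟨k, ⟨hk0, by omega⟩, rfl⟩, k, ⟨hk0, by omega⟩,
      ((lowerWord_eq_upperWord_iff hk0 (by omega)).2 hc).symm⟩

theorem injOn_lowerWord (n : ℕ) : Set.InjOn (lowerWord n) (Set.Icc 1 (n + 1)) := by
  intro k hk l hl h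
  rw [← count_lowerWord hk.1 hk.2, h, count_lowerWord hl.1 hl.2]

theorem injOn_upperWord (n : ℕ) : Set.InjOn (upperWord n) (Set.Icc 1 (n + 1)) := by
  intro k hk l hl h
  rw [← count_upperWord hk.1 hk.2, h, count_upperWord hl.1 hl.2]

theorem mainTheorem2 (n : ℕ) :
    (bispecialWords n).Finite ∧
      ((bispecialWords n).ncard : ℤ) = 2 * ((n : ℤ) + 1) - (Nat.totient (n + 2) : ℤ) := by
  rw [bispecialWords_eq]
  refine ⟨Finset.finite_toSet _, ?_⟩
  rw [Set.ncard_coe_finset]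
  have h := Finset.card_union_add_card_inter ((Finset.Icc 1 (n + 1)).image (lowerWord n))
    ((Finset.Icc 1 (n + 1)).image (upperWord n))
  rw [image_lowerWord_inter_image_upperWord, Finset.card_image_of_injOn (s := Finset.Icc 1 (n + 1))
    (by simpa using injOn_lowerWord n), Finset.card_image_of_injOn (s := Finset.Icc 1 (n + 1))
    (by simpa using injOn_upperWord n), Finset.card_image_of_injOn, Nat.card_Icc] at h
  · rw [Nat.totient_eq_card_coprime]
    omega
  · refine (injOn_lowerWord n).mono fun k hk => ?_
    simp only [Finset.coe_filter, Finset.mem_range, Set.mem_ofPred_eq] at hk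
    have hk0 : k ≠ 0 := fun h0 => by subst h0; simp at hk
    exact ⟨by omega, by omega⟩
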